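/- Let $G=(V,E)$ be a finite graph, possibly with loops or multiple edges, with complex edge weights $\boldsymbol\lambda=(\lambda_e)_{e\in E}$ and, at each vertex $v\in V$, complex activities $u^{(v)}_0,\dots,u^{(v)}_{\deg(G,v)}$. For $H\subseteq E$ let $\deg(H,v)$ be the degree of $v$ in the spanning subgraph $(V,H)$ (a loop at $v$ counts twice), with $\deg(G,v)=\deg(E,v)$, and put $$Z(G,\boldsymbol\lambda,\mathbf u;\mathbf x)=\sum_{H\subseteq E}\Big(\prod_{e\in H}\lambda_e\Big)\Big(\prod_{v\in V}u^{(v)}_{\deg(H,v)}\Big)\prod_{v\in V}x_v^{\deg(H,v)},\qquad K_v(z)=\sum_{j=0}^{\deg(G,v)}\binom{\deg(G,v)}{j}u^{(v)}_j z^j .$$ Call a complex polynomial $F$ in one variable $A$-nonvanishing, for $A\subseteq\mathbb C$, if either $F\equiv 0$ or $F(z)\ne0$ for all $z\in A$. For $0<\theta\le\pi$ let $S[\theta]=\{z\in\mathbb C: z\neq0,\ |\arg z|<\theta\}$, where $-\pi<\arg z\le\pi$, and for $\kappa>0$ let $\kappa D=\{z\in\mathbb C:|z|<\kappa\}$ and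 $\kappa E=\{z\in\mathbb C:|z|>\kappa\}$. Then $Z(G,\boldsymbol\lambda,\mathbf u;y^{1/2}\mathbf 1)$ is a polynomial in $y$ (that is, there is a polynomial $W$ with $W(s^2)=Z(G,\boldsymbol\lambda,\mathbf u;s\mathbf 1)$ for all $s\in\mathbb C$), and the following hold. (a) Let $0\le\alpha<\pi/2$. If every $\lambda_e$ is real and nonnegative, and $K_v$ is $S[\pi-\alpha]$-nonvanishing for every $v\in V$, then $Z(G,\boldsymbol\lambda,\mathbf u;y^{1/2}\mathbf 1)$ is $S[\pi-2\alpha]$-nonvanishing. (b) Let $\kappa>0$ and $\lambda_{\max}>0$. If $|\lambda_e|\le\lambda_{\max}$ for every $e\in E$, and $K_v$ is $\kappa D$-nonvanishing for every $v\in V$, then $Z(G,\boldsymbol\lambda,\mathbf u;y^{1/2}\mathbf 1)$ is $(\kappa^2/\lambda_{\max})D$-nonvanishing. (c) Let $\kappa>0$ and $\lambda_{\min}>0$. If $|\lambda_e|\ge\lambda_{\min}$ for every $e\in E$, and $K_v$ is $\kappa E$-nonvanishing with $\deg K_v=\deg(G,v)$ for every $v\in V$, then $Z(G,\boldsymbol\lambda,\mathbf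 u;y^{1/2}\mathbf 1)$ is $(\kappa^2/\lambda_{\min})E$-nonvanishing. -/

import Mathlib

open scoped Polynomial ComplexOrder

noncomputable section

namespace WeightedSubgraphs

/-! Finite graphs, possibly with loops and multiple edges, are Mathlib's multigraphs `Graph α β`
with finitely many vertices and edges. A spanning subgraph is given by its set `H` of edges. -/

open Classical in
/-- The degree `deg(H, v)` of the vertex `v` in the spanning subgraph with edge set `H`: the number
of edges in `H` incident with `v`, with loops at `v` counted twice. -/
def deg {α β : Type*} (G : Graph α β) (H : Finset G.edgeSet) (v : G.vertexSet) : ℕ :=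
  (H.filter fun e : G.edgeSet => G.Inc e.1 v.1).card +
    (H.filter fun e : G.edgeSet => G.IsLoopAt e.1 v.1).card

/-- The polynomial `Z(G, lam, u; x) = ∑_H lam^H * u_{deg H} * x^{deg H}` in the variables `x_v`
(`v` a vertex), summed over all sets `H` of edges of `G`. The activity `u_j^{(v)}` is `u v j`;
only the values with `j ≤ deg(G, v)` matter. -/
def Z {α β : Type*} (G : Graph α β) [Fintype G.vertexSet] [Fintype G.edgeSet]
    (lam : G.edgeSet → ℂ) (u : G.vertexSet → ℕ → ℂ) : MvPolynomial G.vertexSet ℂ :=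
  ∑ H : Finset G.edgeSet,
    MvPolynomial.C ((∏ e ∈ H, lam e) * ∏ v, u v (deg G H v)) *
      ∏ v, MvPolynomial.X v ^ deg G H v

/-- The key polynomial `K_v(z) = ∑_{j=0}^d (d choose j) u_j^{(v)} z^j` with `d = deg(G, v)`. -/
def key {α β : Type*} (G : Graph α β) [Fintype G.edgeSet]
    (u : G.vertexSet → ℕ → ℂ) (v : G.vertexSet) : ℂ[X] :=
  ∑ j ∈ Finset.range (deg G Finset.univ v + 1),
    Polynomial.C (((deg G Finset.univ v).choose j : ℂ) * u v j) * Polynomial.X ^ j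

/-- `F` is `A`-nonvanishing: either `F` is identically zero or it has no zero in `A`. -/
def Nonvanishing (A : Set ℂ) (F : ℂ[X]) : Prop :=
  F = 0 ∨ ∀ z ∈ A, F.eval z ≠ 0

/-- The open sector `S[θ]` centred on the positive real axis. -/
def sector (θ : ℝ) : Set ℂ := {z | z ≠ 0 ∧ |z.arg| < θ}

/-- The open interior `κ D` of the disk of radius `κ` centred at the origin. -/
def diskInterior (κ : ℝ) : Set ℂ := {z | ‖z‖ < κ}

/-- The open exterior `κ E` of the disk of radius `κ` centred at the origin. -/
def diskExterior (κ : ℝ) : Set ℂ := {z | κ < ‖z‖}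

end WeightedSubgraphs

end

/-!
Split every edge into two half-edges and give each half-edge its own variable. The resulting
polynomial factors over the vertices, and by the Grace–Walsh–Szegő theorem its `v`-th factor has
no zeros with all variables in a disk or half-plane `A` in which `K_v` has none. An edge is
reassembled by forgetting the terms that contain just one of its half-edges and giving weight `μ`
to the pair. By the same theorem in degree two, this is harmless if `μ = -δ ^ 2` with `δ` and `-δ`
in `A`, since the single half-edges then cancel.

With `μ_e = λ_e y` this proves (b), where `A` is the disk. Passing from `H` to its complement
reverses the key polynomials and inverts the weights, so that (c) follows from (b). For (a) write
`y = w ^ 2` and let `A` be the half-plane bisected by `w`. The points `±δ = ±i √λ_e w` are on its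
boundary, so the key polynomials are first translated by `ε > 0`; Hurwitz's theorem deals with the
limit `ε → 0`.
-/

namespace WeightedSubgraphs

open Finset Filter Topology InnerProductGeometry
open scoped InnerProductSpace Pointwise

section Laguerre

/-- The sets for which Laguerre's theorem on polar derivatives holds: seen from each point `z` of
`A`, the complement of `A` on the Riemann sphere becomes convex under the inversion
`r ↦ (z - r)⁻¹`, which sends the point at infinity to `0`. -/
def IsLaguerre (A : Set ℂ) : Prop :=
  ∀ z ∈ A, Convex ℝ {ζ : ℂ | ζ = 0 ∨ z - ζ⁻¹ ∉ A}

/-- The open disk (for `0 < a`) or open half-plane (for `a = 0`) with equation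
`a ‖z‖ ^ 2 < ⟪c, z⟫ + d`. -/
def circularRegion (a : ℝ) (c : ℂ) (d : ℝ) : Set ℂ :=
  {z | a * ‖z‖ ^ 2 < ⟪c, z⟫_ℝ + d}

lemma diskInterior_eq_circularRegion {κ : ℝ} (hκ : 0 ≤ κ) :
    diskInterior κ = circularRegion 1 0 (κ ^ 2) := by
  ext z
  simp [diskInterior, circularRegion, sq_lt_sq₀ (norm_nonneg z) hκ]

lemma sub_inv_notMem_circularRegion_iff (a : ℝ) (c : ℂ) (d : ℝ) (z : ℂ) {ζ : ℂ} (hζ : ζ ≠ 0) :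
    z - ζ⁻¹ ∉ circularRegion a c d ↔
      (⟪c, z⟫_ℝ + d - a * ‖z‖ ^ 2) * ‖ζ‖ ^ 2 + ((2 * a * z - c) * ζ).re ≤ a := by
  have hnorm : 0 < ‖ζ‖ ^ 2 := by positivity
  have hscale : (⟪c, z - ζ⁻¹⟫_ℝ + d - a * ‖z - ζ⁻¹‖ ^ 2) * ‖ζ‖ ^ 2 =
      (⟪c, z⟫_ℝ + d - a * ‖z‖ ^ 2) * ‖ζ‖ ^ 2 + ((2 * a * z - c) * ζ).re - a := by
    have hinv : ζ⁻¹ = starRingEnd ℂ ζ * ((‖ζ‖ ^ 2)⁻¹ : ℝ) := by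
      rw [Complex.inv_def, Complex.normSq_eq_norm_sq]
    have hinner : ⟪c, ζ⁻¹⟫_ℝ * ‖ζ‖ ^ 2 = (c * ζ).re := by
      rw [hinv, Complex.inner, mul_right_comm, Complex.re_mul_ofReal,
        inv_mul_cancel_right₀ hnorm.ne', ← map_mul, Complex.conj_re, mul_comm]
    have hdist : ‖z - ζ⁻¹‖ ^ 2 * ‖ζ‖ ^ 2 = ‖z‖ ^ 2 * ‖ζ‖ ^ 2 - 2 * (z * ζ).re + 1 := by
      rw [← mul_pow, ← norm_mul, sub_mul, inv_mul_cancel₀ hζ, norm_sub_sq_real, norm_mul, norm_one,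
        Complex.inner, one_mul, Complex.conj_re]
      ring
    have hre : ((2 * a * z - c) * ζ).re = 2 * a * (z * ζ).re - (c * ζ).re := by
      rw [sub_mul, Complex.sub_re, mul_assoc, ← Complex.ofReal_ofNat, ← Complex.ofReal_mul,
        Complex.re_ofReal_mul]
    rw [inner_sub_right, hre]
    linear_combination -hinner - a * hdist
  rw [circularRegion, Set.mem_ofPred_eq, not_lt, ← sub_nonpos, ← sub_nonpos (b := a), ← hscale,
    ← mul_le_mul_iff_left₀ hnorm, zero_mul]

lemma isLaguerre_circularRegion {a : ℝ} (ha : 0 ≤ a) (c : ℂ) (d : ℝ) :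
    IsLaguerre (circularRegion a c d) := by
  intro z hz
  have hcoeff : 0 ≤ ⟪c, z⟫_ℝ + d - a * ‖z‖ ^ 2 := (sub_pos.2 hz).le
  have hset : {ζ : ℂ | ζ = 0 ∨ z - ζ⁻¹ ∉ circularRegion a c d} =
      {ζ | ζ ∈ Set.univ ∧
        (⟪c, z⟫_ℝ + d - a * ‖z‖ ^ 2) * ‖ζ‖ ^ 2 + ((2 * a * z - c) * ζ).re ≤ a} := by
    ext ζ
    rcases eq_or_ne ζ 0 with rfl | hζ
    · simpa using ha
    · simp [hζ, sub_inv_notMem_circularRegion_iff]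
  have hquad : ConvexOn ℝ Set.univ fun ζ : ℂ => ‖ζ‖ ^ 2 :=
    convexOn_univ_norm.pow (fun _ _ => norm_nonneg _) 2
  have hlin : ConvexOn ℝ Set.univ fun ζ : ℂ => ((2 * a * z - c) * ζ).re :=
    (Complex.reLm ∘ₗ LinearMap.mulLeft ℝ (2 * a * z - c)).convexOn convex_univ
  rw [hset]
  exact ((hquad.smul hcoeff).add hlin).convex_le a

lemma multiset_sum_mem_smul {E : Type*} [AddCommGroup E] [Module ℝ E] {K : Set E}
    (hK : Convex ℝ K) (h0 : (0 : E) ∈ K) {n : ℕ} {s : Multiset E} (hcard : s.card ≤ n)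
    (hs : ∀ x ∈ s, x ∈ K) : s.sum ∈ (n : ℝ) • K := by
  induction s using Multiset.induction_on generalizing n with
  | empty => exact ⟨0, h0, by simp⟩
  | cons a s ih =>
    obtain ⟨k, rfl⟩ : ∃ k, n = k + 1 := Nat.exists_eq_succ_of_ne_zero (by rintro rfl; simp at hcard)
    rw [Multiset.card_cons, Nat.add_le_add_iff_right] at hcard
    rw [Multiset.forall_mem_cons] at hs
    rw [Multiset.sum_cons, add_comm a, Nat.cast_add, Nat.cast_one,
      hK.add_smul k.cast_nonneg zero_le_one, one_smul]
    exact Set.add_mem_add (ih hcard hs.2) hs.1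

/-- The polar derivative with pole `w` of `p`, viewed as a polynomial of degree at most `n`. -/
noncomputable def polarDerivative {R : Type*} [CommRing R] (n : ℕ) (w : R) (p : R[X]) : R[X] :=
  n * p + (.C w - .X) * p.derivative

/-- **Laguerre's theorem**. If the polar derivative vanishes at `z`, then `(z - w)⁻¹` is the mean of
the numbers `(z - r)⁻¹`, over the roots `r` of `p` and `n - deg p` copies of infinity. -/
lemma eval_polarDerivative_ne_zero {A : Set ℂ} (hA : IsLaguerre A) {p : ℂ[X]} {n : ℕ} (hn : n ≠ 0)
    (hp : p.natDegree ≤ n) (hpA : ∀ z ∈ A, p.eval z ≠ 0) {w z : ℂ} (hw : w ∈ A) (hz : z ∈ A) :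
    (polarDerivative n w p).eval z ≠ 0 := by
  intro hzero
  have hpolar : n * p.eval z + (w - z) * p.derivative.eval z = 0 := by
    simpa [polarDerivative] using hzero
  have hpz : p.eval z ≠ 0 := hpA z hz
  have hn' : (n : ℂ) ≠ 0 := Nat.cast_ne_zero.2 hn
  have hzw : z - w ≠ 0 := by
    intro h
    rw [← neg_sub, h, neg_zero, zero_mul, add_zero] at hpolar
    exact mul_ne_zero hn' hpz hpolar
  have hroots : ∀ x ∈ p.roots.map fun r => 1 / (z - r), x = 0 ∨ z - x⁻¹ ∉ A := by
    simp only [Multiset.mem_map]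
    rintro _ ⟨r, hr, rfl⟩
    rw [one_div, inv_inv, sub_sub_cancel]
    exact .inr fun hrA => hpA r hrA (Polynomial.isRoot_of_mem_roots hr)
  have hsum := multiset_sum_mem_smul (hA z hz) (.inl rfl)
    (by simpa using (Polynomial.card_roots' p).trans hp) hroots
  rw [← (IsAlgClosed.splits p).eval_derivative_div_eval_of_ne_zero hpz] at hsum
  have hmean : p.derivative.eval z / p.eval z = (n : ℝ) • (z - w)⁻¹ := by
    rw [Complex.real_smul, Complex.ofReal_natCast]
    field_simp
    linear_combination -hpolar
  rw [hmean, Set.smul_mem_smul_set_iff₀ (Nat.cast_ne_zero.2 hn)] at hsum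
  rcases hsum with h | h
  · exact hzw (inv_eq_zero.1 h)
  · exact h (by rwa [inv_inv, sub_sub_cancel])

end Laguerre

section GraceWalshSzego

section CommSemiring

variable {R : Type*} [CommSemiring R]

/-- The polynomial `∑_j (d choose j) u_j X^j`. -/
noncomputable def binomialPolynomial (d : ℕ) (u : ℕ → R) : R[X] :=
  ∑ j ∈ range (d + 1), .C (d.choose j * u j) * .X ^ j

lemma coeff_binomialPolynomial (d : ℕ) (u : ℕ → R) (j : ℕ) :
    (binomialPolynomial d u).coeff j = d.choose j * u j := by
  simp only [binomialPolynomial, Polynomial.finsetSum_coeff, Polynomial.coeff_C_mul_X_pow,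
    sum_ite_eq, mem_range, ite_eq_left_iff, not_lt]
  intro hj
  rw [Nat.choose_eq_zero_of_lt hj, Nat.cast_zero, zero_mul]

lemma natDegree_binomialPolynomial_le (d : ℕ) (u : ℕ → R) :
    (binomialPolynomial d u).natDegree ≤ d :=
  Polynomial.natDegree_le_iff_coeff_eq_zero.2 fun j hj => by
    rw [coeff_binomialPolynomial, Nat.choose_eq_zero_of_lt hj, Nat.cast_zero, zero_mul]

lemma binomialPolynomial_add_smul (d : ℕ) (u v : ℕ → R) (w : R) :
    binomialPolynomial d (u + w • v) = binomialPolynomial d u + .C w * binomialPolynomial d v := by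
  ext j
  simp only [Polynomial.coeff_add, Polynomial.coeff_C_mul, coeff_binomialPolynomial, Pi.add_apply,
    Pi.smul_apply, smul_eq_mul]
  ring

lemma binomialPolynomial_succ (d : ℕ) (u : ℕ → R) :
    binomialPolynomial (d + 1) u =
      binomialPolynomial d u + .X * binomialPolynomial d fun j => u (j + 1) := by
  ext (_ | j)
  · simp [coeff_binomialPolynomial]
  · simp only [Polynomial.coeff_add, Polynomial.coeff_X_mul, coeff_binomialPolynomial,
      Nat.choose_succ_succ, Nat.cast_add]
    ring

lemma derivative_binomialPolynomial_succ (d : ℕ) (u : ℕ → R) :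
    (binomialPolynomial (d + 1) u).derivative =
      (d + 1 : ℕ) * binomialPolynomial d fun j => u (j + 1) := by
  ext j
  have hchoose : ((d + 1 : ℕ) : R) * d.choose j = (d + 1).choose (j + 1) * (j + 1 : ℕ) := by
    rw [← Nat.cast_mul, ← Nat.cast_mul, Nat.add_one_mul_choose_eq]
  rw [Polynomial.coeff_derivative, Polynomial.coeff_natCast_mul, coeff_binomialPolynomial,
    coeff_binomialPolynomial, ← mul_assoc, hchoose]
  push_cast
  ring

end CommSemiring

lemma polarDerivative_binomialPolynomial {R : Type*} [CommRing R] (d : ℕ) (u : ℕ → R) (w : R) :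
    polarDerivative (d + 1) w (binomialPolynomial (d + 1) u) =
      (d + 1 : ℕ) * binomialPolynomial d (u + w • fun j => u (j + 1)) := by
  rw [polarDerivative, derivative_binomialPolynomial_succ, binomialPolynomial_add_smul,
    binomialPolynomial_succ]
  ring

/-- The **Grace–Walsh–Szegő theorem**. -/
lemma polarization_ne_zero {ι : Type*} {A : Set ℂ} (hA : IsLaguerre A) (hne : A.Nonempty)
    {s : Finset ι} {z : ι → ℂ} (hz : ∀ i ∈ s, z i ∈ A) {u : ℕ → ℂ}
    (hu : ∀ x ∈ A, (binomialPolynomial #s u).eval x ≠ 0) :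
    ∑ S ∈ s.powerset, u #S * ∏ i ∈ S, z i ≠ 0 := by
  classical
  induction s using Finset.induction_on generalizing u with
  | empty =>
    obtain ⟨x, hx⟩ := hne
    simpa [binomialPolynomial] using hu x hx
  | insert a s ha ih =>
    rw [card_insert_of_notMem ha] at hu
    rw [forall_mem_insert] at hz
    have hrec : ∑ S ∈ (insert a s).powerset, u #S * ∏ i ∈ S, z i =
        ∑ S ∈ s.powerset, (u + z a • fun j => u (j + 1)) #S * ∏ i ∈ S, z i := by
      rw [sum_powerset_insert ha, ← sum_add_distrib]
      refine sum_congr rfl fun S hS => ?_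
      have haS : a ∉ S := fun h => ha (mem_powerset.1 hS h)
      rw [card_insert_of_notMem haS, prod_insert haS, Pi.add_apply, Pi.smul_apply, smul_eq_mul]
      ring
    rw [hrec]
    refine ih hz.2 fun x hx => right_ne_zero_of_mul (a := ((#s + 1 : ℕ) : ℂ)) ?_
    have hpolar := eval_polarDerivative_ne_zero hA (Nat.succ_ne_zero #s)
      (natDegree_binomialPolynomial_le _ u) hu hz.1 hx
    rwa [Nat.succ_eq_add_one, polarDerivative_binomialPolynomial, Polynomial.eval_mul,
      Polynomial.eval_natCast] at hpolar

end GraceWalshSzego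

section Hurwitz

variable {K : Type*} [NormedField K] [IsAlgClosed K]

lemma norm_eval_le_of_forall_ball_eval_ne_zero {p : K[X]} {m : ℕ} (hp : p.natDegree ≤ m) {y₀ : K}
    {r : ℝ} (hr : 0 < r) (h : ∀ z ∈ Metric.ball y₀ r, p.eval z ≠ 0) (y : K) :
    ‖p.eval y‖ ≤ ‖p.eval y₀‖ * (1 + ‖y - y₀‖ / r) ^ m := by
  have hroot : ∀ x ∈ p.roots, ‖y - x‖ ≤ ‖y₀ - x‖ * (1 + ‖y - y₀‖ / r) := by
    intro x hx
    have hfar : r ≤ ‖y₀ - x‖ := by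
      by_contra! hlt
      exact h x (by rwa [mem_ball_iff_norm']) (Polynomial.isRoot_of_mem_roots hx)
    calc ‖y - x‖ ≤ ‖y₀ - x‖ + r * (‖y - y₀‖ / r) := by
          rw [mul_div_cancel₀ _ hr.ne', add_comm]
          exact norm_sub_le_norm_sub_add_norm_sub _ _ _
      _ ≤ ‖y₀ - x‖ + ‖y₀ - x‖ * (‖y - y₀‖ / r) := by gcongr
      _ = ‖y₀ - x‖ * (1 + ‖y - y₀‖ / r) := by ring
  have hone : 1 ≤ 1 + ‖y - y₀‖ / r := le_add_of_nonneg_right (by positivity)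
  have hnorm : ∀ x, ‖p.eval x‖ = ‖p.leadingCoeff‖ * (p.roots.map fun a => ‖x - a‖).prod := by
    intro x
    rw [(IsAlgClosed.splits p).eval_eq_prod_roots x, norm_mul]
    congr 1
    simpa using map_multiset_prod (normHom (α := K)) (p.roots.map (x - ·))
  calc ‖p.eval y‖
      ≤ ‖p.leadingCoeff‖ * (p.roots.map fun a => ‖y₀ - a‖ * (1 + ‖y - y₀‖ / r)).prod := by
        rw [hnorm]
        gcongr
        exact Multiset.prod_map_le_prod_map₀ _ _ (fun _ _ => norm_nonneg _) hroot
    _ = ‖p.eval y₀‖ * (1 + ‖y - y₀‖ / r) ^ p.roots.card := by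
        rw [hnorm, Multiset.prod_map_mul, Multiset.map_const', Multiset.prod_replicate, mul_assoc]
    _ ≤ ‖p.eval y₀‖ * (1 + ‖y - y₀‖ / r) ^ m := by
        gcongr
        exact (Polynomial.card_roots' p).trans hp

/-- **Hurwitz's theorem** for polynomials. -/
lemma eq_zero_or_eval_ne_zero_of_tendsto {ι : Type*} {l : Filter ι} [l.NeBot] {p : ι → K[X]}
    {q : K[X]} {m : ℕ} (hp : ∀ᶠ i in l, (p i).natDegree ≤ m)
    (hlim : ∀ z, Tendsto (fun i => (p i).eval z) l (𝓝 (q.eval z))) {U : Set K} (hU : IsOpen U)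
    (hpU : ∀ᶠ i in l, ∀ z ∈ U, (p i).eval z ≠ 0) : q = 0 ∨ ∀ z ∈ U, q.eval z ≠ 0 := by
  refine or_iff_not_imp_right.2 fun hne => Polynomial.funext fun y => ?_
  push Not at hne
  obtain ⟨y₀, hy₀, hzero⟩ := hne
  obtain ⟨r, hr, hball⟩ := Metric.isOpen_iff.1 hU y₀ hy₀
  have hbound := ((hlim y₀).norm.mul_const ((1 + ‖y - y₀‖ / r) ^ m))
  rw [hzero, norm_zero, zero_mul] at hbound
  rw [Polynomial.eval_zero, ← norm_le_zero_iff]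
  refine le_of_tendsto_of_tendsto (hlim y).norm hbound ?_
  filter_upwards [hp, hpU] with i hdeg hi
  exact norm_eval_le_of_forall_ball_eval_ne_zero hdeg hr (fun z hz => hi z (hball hz)) y

end Hurwitz

section HalfEdges

lemma sum_prod_filter_eq_prod_sum_powerset {ι V R : Type*} [Fintype ι] [Fintype V] [DecidableEq V]
    [CommSemiring R] (t : ι → V) (f : V → Finset ι → R) :
    ∑ S, ∏ v, f v {i ∈ S | t i = v} = ∏ v, ∑ S ∈ powerset {i | t i = v}, f v S := by
  classical
  rw [prod_univ_sum]
  refine sum_bij' (fun S _ v => {i ∈ S | t i = v}) (fun p _ => ({i | i ∈ p (t i)} : Finset ι))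
    ?_ ?_ ?_ ?_ ?_
  · exact fun S _ => Fintype.mem_piFinset.2 fun v =>
      mem_powerset.2 (filter_subset_filter _ (subset_univ S))
  · simp
  · intro S _
    ext i
    simp
  · intro p hp
    ext v i
    have hmem : i ∈ p v → t i = v := fun hi => by
      simpa using mem_powerset.1 (Fintype.mem_piFinset.1 hp v) hi
    simp only [mem_filter, mem_univ, true_and]
    exact ⟨fun ⟨hi, hv⟩ => hv ▸ hi, fun hi => ⟨(hmem hi).symm ▸ hi, hmem hi⟩⟩
  · exact fun _ _ => rfl

/-- The product of the vertex activities of a set `S` of half-edges, where `t h` is the vertex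
at which the half-edge `h` is attached. -/
noncomputable def activity {ι V R : Type*} [Fintype V] [DecidableEq V] [CommMonoid R] (t : ι → V)
    (u : V → ℕ → R) (S : Finset ι) : R :=
  ∏ v, u v #{h ∈ S | t h = v}

lemma sum_activity_mul_prod_ne_zero {ι V : Type*} [Fintype ι] [Fintype V] [DecidableEq V]
    {A : Set ℂ} (hA : IsLaguerre A) (hne : A.Nonempty) {t : ι → V} {u : V → ℕ → ℂ}
    (hu : ∀ v, ∀ x ∈ A, (binomialPolynomial #{h | t h = v} (u v)).eval x ≠ 0) {z : ι → ℂ}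
    (hz : ∀ h, z h ∈ A) : ∑ S, activity t u S * ∏ h ∈ S, z h ≠ 0 := by
  classical
  have hfactor : ∑ S, activity t u S * ∏ h ∈ S, z h =
      ∏ v, ∑ S ∈ powerset {h | t h = v}, u v #S * ∏ h ∈ S, z h := by
    rw [← sum_prod_filter_eq_prod_sum_powerset]
    simp only [activity, prod_mul_distrib, prod_fiberwise]
  rw [hfactor]
  exact prod_ne_zero_iff.2 fun v _ => polarization_ne_zero hA hne (fun h _ => hz h) (hu v)

lemma multilinearMap_apply_ne_zero {R ι N : Type*} {M : ι → Type*} [Finite ι]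
    [CommSemiring R] [∀ i, AddCommMonoid (M i)] [AddCommMonoid N] [∀ i, Module R (M i)] [Module R N]
    (L : MultilinearMap R M N) {P : ∀ i, Set (M i)} (hL : ∀ p, (∀ i, p i ∈ P i) → L p ≠ 0)
    {q : ∀ i, M i} (hq : ∀ i, ∀ l : M i →ₗ[R] N, (∀ x ∈ P i, l x ≠ 0) → l (q i) ≠ 0) :
    L q ≠ 0 := by
  classical
  cases nonempty_fintype ι
  have hP : ∀ i, ∃ x, x ∈ P i := by
    by_contra! ⟨i, hi⟩
    exact hq i 0 (fun x hx => absurd hx (hi x)) rfl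
  have hmixed : ∀ T : Finset ι, ∀ p, (∀ i, p i ∈ P i) → L (T.piecewise q p) ≠ 0 := by
    intro T
    induction T using Finset.induction_on with
    | empty => simpa using hL
    | insert a T ha ih =>
      intro p hp
      rw [piecewise_insert]
      refine hq a (L.toLinearMap (T.piecewise q p) a) fun x hx => ?_
      rw [MultilinearMap.toLinearMap_apply, update_piecewise_of_notMem T q p ha]
      exact ih _ ((Function.forall_update_iff p fun i y => y ∈ P i).2 ⟨hx, fun i _ => hp i⟩)
  choose p hp using hP
  simpa using hmixed univ p hp

/-- The weight of a set `T` of half-edges of a single edge once the edge has been contracted: the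
two half-edges are taken together, with weight `μ`, or not at all. -/
def contractedWeight (μ : ℂ) (T : Finset Bool) : ℂ :=
  if T = ∅ then 1 else if T = univ then μ else 0

/-- A function of `#T` cannot tell `δ ^ #T` from its polarization, in which the two half-edges
carry `δ` and `-δ`: the single half-edges cancel and the pair has weight `-δ ^ 2`. -/
lemma map_contractedWeight_ne_zero {A : Set ℂ} (hA : IsLaguerre A) {δ : ℂ} (hδ : δ ∈ A)
    (hδ' : -δ ∈ A) (l : (Finset Bool → ℂ) →ₗ[ℂ] ℂ) (hl : ∀ x ∈ A, l (fun T => x ^ #T) ≠ 0) :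
    l (contractedWeight (-δ ^ 2)) ≠ 0 := by
  set f : ℕ → Finset Bool → ℂ := fun j T => if #T = j then 1 else 0 with hf
  set u : ℕ → ℂ := fun j => l (f j) / Nat.choose 2 j with hu
  have hpow : ∀ x : ℂ, (fun T : Finset Bool => x ^ #T) = f 0 + x • f 1 + x ^ 2 • f 2 := by
    intro x
    ext T
    have hcard : #T ≤ 2 := card_le_univ T
    interval_cases h : #T <;> simp [hf, h, -card_eq_zero]
  have heval : ∀ x ∈ A, (binomialPolynomial #(univ : Finset Bool) u).eval x ≠ 0 := by
    intro x hx
    convert hl x hx using 1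
    rw [hpow, binomialPolynomial, card_univ, Fintype.card_bool]
    simp only [hu, sum_range_succ, sum_range_zero, Nat.choose_zero_right, Nat.choose_one_right,
      Nat.choose_self, Nat.cast_one, Nat.cast_ofNat, Polynomial.eval_add, Polynomial.eval_mul,
      Polynomial.eval_C, Polynomial.eval_pow, Polynomial.eval_X, Polynomial.eval_zero, map_add,
      map_smul, smul_eq_mul]
    ring
  have hcontracted : contractedWeight (-δ ^ 2) = f 0 + (-δ ^ 2) • f 2 := by
    ext T
    simp only [contractedWeight, ← card_eq_zero, ← card_eq_iff_eq_univ, Fintype.card_bool]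
    split_ifs <;> simp [*, -card_eq_zero]
  have huniv : (univ : Finset Bool).powerset = {∅, {false}, {true}, univ} := by decide
  have hpolar := polarization_ne_zero hA ⟨δ, hδ⟩ (s := univ) (z := fun b => cond b δ (-δ))
    (by simp [hδ, hδ']) heval
  rw [hcontracted]
  convert hpolar using 1
  rw [huniv, sum_insert (by decide), sum_insert (by decide), sum_insert (by decide),
    sum_singleton]
  simp only [hu, map_add, map_smul, smul_eq_mul, card_empty, card_singleton, card_univ,
    Fintype.card_bool, Nat.choose_zero_right, Nat.choose_one_right, Nat.choose_self, Nat.cast_one,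
    Nat.cast_ofNat, prod_empty, prod_singleton, Fintype.prod_bool, cond_true, cond_false]
  ring

section Slice

variable {E : Type*} [DecidableEq E]

/-- The half-edges of the edge `e` in the set `S`, when the half-edges are the pairs `(e, b)`. -/
def slice (S : Finset (E × Bool)) (e : E) : Finset Bool := {b | (e, b) ∈ S}

lemma mem_slice {S : Finset (E × Bool)} {e : E} {b : Bool} : b ∈ slice S e ↔ (e, b) ∈ S := by
  simp [slice]

lemma slice_product (H : Finset E) (e : E) :
    slice (H ×ˢ univ) e = if e ∈ H then univ else ∅ := by
  ext b
  split_ifs with h <;> simp [mem_slice, h]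

variable [Fintype E]

lemma prod_slice {R : Type*} [CommMonoid R] (S : Finset (E × Bool)) (z : E × Bool → R) :
    ∏ e, ∏ b ∈ slice S e, z (e, b) = ∏ h ∈ S, z h := by
  simp only [slice, prod_filter]
  rw [← Fintype.prod_prod_type fun h => if h ∈ S then z h else 1, Fintype.prod_ite_mem]

/-- The multilinear form `m ↦ ∑_S c(S) ∏_e m_e(S ∩ e)`, over all sets `S` of half-edges. -/
noncomputable def halfEdgeForm (c : Finset (E × Bool) → ℂ) :
    MultilinearMap ℂ (fun _ : E => Finset Bool → ℂ) ℂ :=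
  ∑ S, c S • (MultilinearMap.mkPiAlgebra ℂ E ℂ).compLinearMap fun e => .proj (slice S e)

lemma halfEdgeForm_apply (c : Finset (E × Bool) → ℂ) (m : E → Finset Bool → ℂ) :
    halfEdgeForm c m = ∑ S, c S * ∏ e, m e (slice S e) := by
  simp [halfEdgeForm]

lemma prod_contractedWeight_slice_product (H : Finset E) (μ : E → ℂ) :
    ∏ e, contractedWeight (μ e) (slice (H ×ˢ univ) e) = ∏ e ∈ H, μ e := by
  rw [← Fintype.prod_ite_mem H μ]
  refine Fintype.prod_congr _ _ fun e => ?_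
  rw [slice_product]
  split_ifs <;> simp [contractedWeight]

lemma eq_product_of_prod_contractedWeight_ne_zero {S : Finset (E × Bool)} {μ : E → ℂ}
    (h : ∏ e, contractedWeight (μ e) (slice S e) ≠ 0) :
    S = ({e | slice S e = univ} : Finset E) ×ˢ univ := by
  ext ⟨e, b⟩
  have he : slice S e = ∅ ∨ slice S e = univ := by
    by_contra hne
    rw [not_or] at hne
    exact prod_ne_zero_iff.1 h e (mem_univ e) (by rw [contractedWeight, if_neg hne.1, if_neg hne.2])
  rw [← mem_slice]
  rcases he with he | he <;> simp [he, univ_nonempty.ne_empty.symm, -Fintype.univ_bool]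

lemma halfEdgeForm_contractedWeight (c : Finset (E × Bool) → ℂ) (μ : E → ℂ) :
    halfEdgeForm c (fun e => contractedWeight (μ e)) =
      ∑ H : Finset E, c (H ×ˢ univ) * ∏ e ∈ H, μ e := by
  rw [halfEdgeForm_apply]
  symm
  refine sum_of_injOn (· ×ˢ univ) ?_ (by simp) (fun S _ hS => ?_) fun H _ => ?_
  · intro H _ H' _ h
    ext e
    simpa using congrArg ((e, true) ∈ ·) h
  · by_contra hne
    exact hS ⟨_, mem_coe.2 (mem_univ _),
      (eq_product_of_prod_contractedWeight_ne_zero (right_ne_zero_of_mul hne)).symm⟩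
  · rw [prod_contractedWeight_slice_product]

end Slice

lemma sum_activity_product_mul_prod_ne_zero {E V : Type*} [Fintype E] [Fintype V] [DecidableEq V]
    {A : Set ℂ} (hA : IsLaguerre A) (hne : A.Nonempty) {t : E × Bool → V} {u : V → ℕ → ℂ}
    (hu : ∀ v, ∀ x ∈ A, (binomialPolynomial #{h | t h = v} (u v)).eval x ≠ 0) {μ : E → ℂ}
    (hμ : ∀ e, ∃ δ ∈ A, -δ ∈ A ∧ μ e = -δ ^ 2) :
    ∑ H : Finset E, activity t u (H ×ˢ univ) * ∏ e ∈ H, μ e ≠ 0 := by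
  classical
  rw [← halfEdgeForm_contractedWeight]
  refine multilinearMap_apply_ne_zero _
    (P := fun _ => (fun (x : ℂ) (T : Finset Bool) => x ^ #T) '' A) (fun p hp => ?_) fun e l hl => ?_
  · choose x hx hxp using hp
    rw [halfEdgeForm_apply]
    simp only [← hxp, ← prod_const, prod_slice _ fun h => x h.1]
    exact sum_activity_mul_prod_ne_zero hA hne hu fun h => hx h.1
  · obtain ⟨δ, hδ, hδ', hμδ⟩ := hμ e
    rw [hμδ]
    exact map_contractedWeight_ne_zero hA hδ hδ' l fun x hx => hl _ ⟨x, hx, rfl⟩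

end HalfEdges

section Graph

variable {α β : Type*} {G : Graph α β}

lemma exists_halfEdge_ends (G : Graph α β) :
    ∃ t : G.edgeSet × Bool → G.vertexSet,
      ∀ e, G.IsLink e.1 (t (e, false)).1 (t (e, true)).1 := by
  have hends : ∀ e : G.edgeSet, ∃ x y : G.vertexSet, G.IsLink e.1 x.1 y.1 := fun e => by
    obtain ⟨x, y, hxy⟩ := G.exists_isLink_of_mem_edgeSet e.2
    exact ⟨⟨x, hxy.left_mem⟩, ⟨y, hxy.right_mem⟩, hxy⟩
  choose x y hxy using hends
  exact ⟨fun h => cond h.2 (y h.1) (x h.1), hxy⟩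

open Classical in
lemma deg_eq_sum (H : Finset G.edgeSet) (v : G.vertexSet) :
    deg G H v = ∑ e ∈ H,
      ((if G.Inc e.1 v.1 then 1 else 0) + if G.IsLoopAt e.1 v.1 then 1 else 0) := by
  rw [deg, card_filter, card_filter, sum_add_distrib]

open Classical in
lemma deg_eq_card_halfEdges {t : G.edgeSet × Bool → G.vertexSet}
    (ht : ∀ e, G.IsLink e.1 (t (e, false)).1 (t (e, true)).1) (H : Finset G.edgeSet)
    (v : G.vertexSet) : deg G H v = #{h ∈ H ×ˢ univ | t h = v} := by
  rw [deg_eq_sum, card_filter, sum_product]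
  refine sum_congr rfl fun e _ => ?_
  have hinc : G.Inc e.1 v.1 ↔ t (e, false) = v ∨ t (e, true) = v := by
    constructor
    · simpa only [Subtype.ext_iff, eq_comm] using fun h : G.Inc e.1 v.1 =>
        h.eq_or_eq_of_isLink (ht e)
    · rintro (rfl | rfl)
      exacts [(ht e).inc_left, (ht e).inc_right]
  have hloop : G.IsLoopAt e.1 v.1 ↔ t (e, false) = v ∧ t (e, true) = v := by
    rw [← Graph.isLink_self_iff, (ht e).isLink_iff, Subtype.ext_iff, Subtype.ext_iff]
    tauto
  rw [Fintype.sum_bool]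
  by_cases h₁ : t (e, false) = v <;> by_cases h₂ : t (e, true) = v <;> simp [hinc, hloop, h₁, h₂]

lemma sum_deg [Fintype G.vertexSet] (H : Finset G.edgeSet) : ∑ v, deg G H v = 2 * #H := by
  classical
  obtain ⟨t, ht⟩ := exists_halfEdge_ends G
  simp only [deg_eq_card_halfEdges ht]
  rw [← card_eq_sum_card_fiberwise (by simp [Set.MapsTo]), card_product, card_univ,
    Fintype.card_bool, mul_comm]

variable [Fintype G.edgeSet]

lemma deg_add_deg_compl [DecidableEq G.edgeSet] (H : Finset G.edgeSet) (v : G.vertexSet) :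
    deg G H v + deg G Hᶜ v = deg G univ v := by
  simp only [deg_eq_sum, sum_add_sum_compl]

lemma deg_le_deg_univ (H : Finset G.edgeSet) (v : G.vertexSet) : deg G H v ≤ deg G univ v := by
  classical
  exact (deg_add_deg_compl H v).subst (motive := (_ ≤ ·)) le_self_add

lemma key_eq_binomialPolynomial (u : G.vertexSet → ℕ → ℂ) (v : G.vertexSet) :
    key G u v = binomialPolynomial (deg G univ v) (u v) :=
  rfl

lemma coeff_key (u : G.vertexSet → ℕ → ℂ) (v : G.vertexSet) (j : ℕ) :
    (key G u v).coeff j = (deg G univ v).choose j * u v j :=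
  coeff_binomialPolynomial _ _ _

/-- The activities for which the key polynomial of each vertex `v` is `p v`, provided that the
degree of `p v` is at most that of `v`. -/
noncomputable def keyActivity (G : Graph α β) [Fintype G.edgeSet] (p : G.vertexSet → ℂ[X])
    (v : G.vertexSet) (j : ℕ) : ℂ :=
  (p v).coeff j / (deg G univ v).choose j

lemma key_keyActivity {p : G.vertexSet → ℂ[X]} {v : G.vertexSet}
    (hp : (p v).natDegree ≤ deg G univ v) : key G (keyActivity G p) v = p v := by
  ext j
  rw [coeff_key, keyActivity]
  rcases le_or_gt j (deg G univ v) with hj | hj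
  · exact mul_div_cancel₀ _ (Nat.cast_ne_zero.2 (Nat.choose_pos hj).ne')
  · rw [Nat.choose_eq_zero_of_lt hj, Nat.cast_zero, zero_mul,
      Polynomial.coeff_eq_zero_of_natDegree_lt (hp.trans_lt hj)]

lemma keyActivity_key (u : G.vertexSet → ℕ → ℂ) {v : G.vertexSet} {j : ℕ}
    (hj : j ≤ deg G univ v) : keyActivity G (key G u) v j = u v j := by
  rw [keyActivity, coeff_key]
  exact mul_div_cancel_left₀ _ (Nat.cast_ne_zero.2 (Nat.choose_pos hj).ne')

/-- The activities read backwards; they belong to the complements of the sets of edges. -/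
noncomputable def reverseActivity (G : Graph α β) [Fintype G.edgeSet] (u : G.vertexSet → ℕ → ℂ)
    (v : G.vertexSet) (j : ℕ) : ℂ :=
  u v (deg G univ v - j)

lemma key_reverseActivity {u : G.vertexSet → ℕ → ℂ} {v : G.vertexSet}
    (h : (key G u v).natDegree = deg G univ v) :
    key G (reverseActivity G u) v = (key G u v).reverse := by
  ext j
  rw [Polynomial.coeff_reverse, h, coeff_key, coeff_key, reverseActivity]
  rcases le_or_gt j (deg G univ v) with hj | hj
  · rw [Polynomial.revAt_le hj, Nat.choose_symm hj]
  · rw [Polynomial.revAt_eq_self_of_lt hj, Nat.choose_eq_zero_of_lt hj, Nat.cast_zero, zero_mul,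
      zero_mul]

lemma eval_reverse_ne_zero_of_diskExterior {p : ℂ[X]} {κ : ℝ} (hκ : 0 < κ)
    (hp : ∀ z ∈ diskExterior κ, p.eval z ≠ 0) {z : ℂ} (hz : z ∈ diskInterior κ⁻¹) :
    p.reverse.eval z ≠ 0 := by
  rcases eq_or_ne z 0 with rfl | hz₀
  · rw [← Polynomial.coeff_zero_eq_eval_zero, Polynomial.coeff_zero_reverse,
      Polynomial.leadingCoeff_ne_zero]
    rintro rfl
    have hmem : ((κ + 1 : ℝ) : ℂ) ∈ diskExterior κ := by
      rw [diskExterior, Set.mem_ofPred_eq, Complex.norm_real, Real.norm_of_nonneg (by positivity)]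
      exact lt_add_one κ
    exact hp _ hmem Polynomial.eval_zero
  · have hz' : z⁻¹ ∈ diskExterior κ := by
      rw [diskExterior, Set.mem_ofPred_eq, norm_inv]
      exact (lt_inv_comm₀ (norm_pos_iff.2 hz₀) hκ).1 hz
    have : Invertible z⁻¹ := invertibleOfNonzero (inv_ne_zero hz₀)
    have hrev := (Polynomial.eval₂_reverse_eq_zero_iff (RingHom.id ℂ) z⁻¹ p).not.2 (hp _ hz')
    rwa [invOf_eq_inv, inv_inv] at hrev

variable [Fintype G.vertexSet]

/-- The value `∑_H ∏_{e ∈ H} μ_e ∏_v u_v(deg(H, v))` of `Z(G, μ, u; x)` at `x = 1`. -/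
noncomputable def subgraphSum (G : Graph α β) [Fintype G.vertexSet] [Fintype G.edgeSet]
    (μ : G.edgeSet → ℂ) (u : G.vertexSet → ℕ → ℂ) : ℂ :=
  ∑ H : Finset G.edgeSet, (∏ e ∈ H, μ e) * ∏ v, u v (deg G H v)

lemma subgraphSum_keyActivity_key (μ : G.edgeSet → ℂ) (u : G.vertexSet → ℕ → ℂ) :
    subgraphSum G μ (keyActivity G (key G u)) = subgraphSum G μ u := by
  simp only [subgraphSum, keyActivity_key u (deg_le_deg_univ _ _)]

lemma subgraphSum_eq_zero {u : G.vertexSet → ℕ → ℂ} {v : G.vertexSet} (h : key G u v = 0)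
    (μ : G.edgeSet → ℂ) : subgraphSum G μ u = 0 := by
  rw [← subgraphSum_keyActivity_key]
  refine sum_eq_zero fun H _ => mul_eq_zero_of_right _ (prod_eq_zero (mem_univ v) ?_)
  rw [keyActivity, h, Polynomial.coeff_zero, zero_div]

lemma subgraphSum_ne_zero {A : Set ℂ} (hA : IsLaguerre A) (hne : A.Nonempty) {μ : G.edgeSet → ℂ}
    {u : G.vertexSet → ℕ → ℂ} (hμ : ∀ e, ∃ δ ∈ A, -δ ∈ A ∧ μ e = -δ ^ 2)
    (hu : ∀ v, ∀ x ∈ A, (key G u v).eval x ≠ 0) : subgraphSum G μ u ≠ 0 := by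
  classical
  obtain ⟨t, ht⟩ := exists_halfEdge_ends G
  have hdeg : ∀ v, deg G univ v = #{h | t h = v} := fun v => by
    rw [deg_eq_card_halfEdges ht, univ_product_univ]
  simp only [key_eq_binomialPolynomial, hdeg] at hu
  simpa only [subgraphSum, activity, ← deg_eq_card_halfEdges ht, mul_comm] using
    sum_activity_product_mul_prod_ne_zero hA hne hu hμ

lemma subgraphSum_ne_zero_of_diskInterior {κ : ℝ} (hκ : 0 < κ) {μ : G.edgeSet → ℂ}
    {u : G.vertexSet → ℕ → ℂ} (hμ : ∀ e, ‖μ e‖ < κ ^ 2)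
    (hu : ∀ v, ∀ z ∈ diskInterior κ, (key G u v).eval z ≠ 0) : subgraphSum G μ u ≠ 0 := by
  have hdisk : IsLaguerre (diskInterior κ) := by
    rw [diskInterior_eq_circularRegion hκ.le]
    exact isLaguerre_circularRegion zero_le_one 0 (κ ^ 2)
  refine subgraphSum_ne_zero hdisk ⟨0, by simpa [diskInterior] using hκ⟩ (fun e => ?_) hu
  obtain ⟨δ, hδ⟩ := IsAlgClosed.exists_pow_nat_eq (-μ e) two_pos
  have hδκ : ‖δ‖ < κ := by
    rw [← sq_lt_sq₀ (norm_nonneg δ) hκ.le, ← norm_pow, hδ, norm_neg]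
    exact hμ e
  exact ⟨δ, hδκ, by simpa [diskInterior] using hδκ, by rw [hδ, neg_neg]⟩

lemma prod_mul_subgraphSum_inv_reverseActivity {μ : G.edgeSet → ℂ} (hμ : ∀ e, μ e ≠ 0)
    (u : G.vertexSet → ℕ → ℂ) :
    (∏ e, μ e) * subgraphSum G (fun e => (μ e)⁻¹) (reverseActivity G u) = subgraphSum G μ u := by
  classical
  rw [subgraphSum, subgraphSum, mul_sum]
  refine Fintype.sum_bijective compl compl_bijective _ _ fun H => ?_
  have hprod : (∏ e, μ e) * ∏ e ∈ H, (μ e)⁻¹ = ∏ e ∈ Hᶜ, μ e := by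
    rw [← prod_mul_prod_compl H μ, prod_inv_distrib, mul_right_comm,
      mul_inv_cancel₀ (prod_ne_zero_iff.2 fun e _ => hμ e), one_mul]
  rw [← mul_assoc, hprod]
  simp only [reverseActivity, ← deg_add_deg_compl H, Nat.add_sub_cancel_left]

lemma subgraphSum_ne_zero_of_diskExterior {κ : ℝ} (hκ : 0 < κ) {μ : G.edgeSet → ℂ}
    {u : G.vertexSet → ℕ → ℂ} (hμ : ∀ e, κ ^ 2 < ‖μ e‖)
    (hu : ∀ v, ∀ z ∈ diskExterior κ, (key G u v).eval z ≠ 0)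
    (hdeg : ∀ v, (key G u v).natDegree = deg G univ v) : subgraphSum G μ u ≠ 0 := by
  have hμ₀ : ∀ e, μ e ≠ 0 := fun e => norm_pos_iff.1 ((pow_pos hκ 2).trans (hμ e))
  rw [← prod_mul_subgraphSum_inv_reverseActivity hμ₀]
  refine mul_ne_zero (prod_ne_zero_iff.2 fun e _ => hμ₀ e)
    (subgraphSum_ne_zero_of_diskInterior (inv_pos.2 hκ) (fun e => ?_) fun v z hz => ?_)
  · rw [norm_inv, inv_pow]
    exact inv_strictAnti₀ (pow_pos hκ 2) (hμ e)
  · rw [key_reverseActivity (hdeg v)]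
    exact eval_reverse_ne_zero_of_diskExterior hκ (hu v) hz

/-- The polynomial `∑_H λ^H ∏_v u_v(deg(H, v)) y^|H|` in `y`, which is `Z(G, λ, u; y^{1/2} 1)`. -/
noncomputable def edgePolynomial (G : Graph α β) [Fintype G.vertexSet] [Fintype G.edgeSet]
    (lam : G.edgeSet → ℂ) (u : G.vertexSet → ℕ → ℂ) : ℂ[X] :=
  ∑ H : Finset G.edgeSet, .C ((∏ e ∈ H, lam e) * ∏ v, u v (deg G H v)) * .X ^ #H

lemma natDegree_edgePolynomial_le (lam : G.edgeSet → ℂ) (u : G.vertexSet → ℕ → ℂ) :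
    (edgePolynomial G lam u).natDegree ≤ Fintype.card G.edgeSet :=
  Polynomial.natDegree_sum_le_of_forall_le _ _ fun H _ =>
    (Polynomial.natDegree_C_mul_X_pow_le _ _).trans (card_le_univ H)

lemma eval_edgePolynomial (lam : G.edgeSet → ℂ) (u : G.vertexSet → ℕ → ℂ) (y : ℂ) :
    (edgePolynomial G lam u).eval y = subgraphSum G (fun e => lam e * y) u := by
  simp only [edgePolynomial, subgraphSum, Polynomial.eval_finsetSum, Polynomial.eval_mul,
    Polynomial.eval_C, Polynomial.eval_pow, Polynomial.eval_X, prod_mul_distrib, prod_const,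
    mul_right_comm]

lemma eval_edgePolynomial_sq (lam : G.edgeSet → ℂ) (u : G.vertexSet → ℕ → ℂ) (s : ℂ) :
    (edgePolynomial G lam u).eval (s ^ 2) = MvPolynomial.eval (fun _ => s) (Z G lam u) := by
  simp only [edgePolynomial, Z, Polynomial.eval_finsetSum, Polynomial.eval_mul,
    Polynomial.eval_prod, Polynomial.eval_C, Polynomial.eval_pow, Polynomial.eval_X, map_sum,
    map_mul, map_prod, map_pow, MvPolynomial.eval_C, MvPolynomial.eval_X, prod_pow_eq_pow_sum,
    sum_deg, pow_mul]

lemma edgePolynomial_keyActivity_key (lam : G.edgeSet → ℂ) (u : G.vertexSet → ℕ → ℂ) :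
    edgePolynomial G lam (keyActivity G (key G u)) = edgePolynomial G lam u :=
  Polynomial.funext fun y => by
    rw [eval_edgePolynomial, eval_edgePolynomial, subgraphSum_keyActivity_key]

lemma nonvanishing_edgePolynomial_of_eval_key_ne_zero {A B : Set ℂ} {lam : G.edgeSet → ℂ}
    {u : G.vertexSet → ℕ → ℂ} (hu : ∀ v, Nonvanishing A (key G u v))
    (h : (∀ v, ∀ z ∈ A, (key G u v).eval z ≠ 0) → Nonvanishing B (edgePolynomial G lam u)) :
    Nonvanishing B (edgePolynomial G lam u) := by
  by_cases hzero : ∃ v, key G u v = 0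
  · obtain ⟨v, hv⟩ := hzero
    exact .inl <| Polynomial.funext fun y => by
      rw [eval_edgePolynomial, subgraphSum_eq_zero hv, Polynomial.eval_zero]
  · exact h fun v => (hu v).resolve_left fun hv => hzero ⟨v, hv⟩

lemma nonvanishing_edgePolynomial_diskInterior {κ lamMax : ℝ} (hκ : 0 < κ) (hmax : 0 < lamMax)
    {lam : G.edgeSet → ℂ} (hlam : ∀ e, ‖lam e‖ ≤ lamMax) {u : G.vertexSet → ℕ → ℂ}
    (hu : ∀ v, Nonvanishing (diskInterior κ) (key G u v)) :
    Nonvanishing (diskInterior (κ ^ 2 / lamMax)) (edgePolynomial G lam u) := by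
  refine nonvanishing_edgePolynomial_of_eval_key_ne_zero hu fun hu => .inr fun y hy => ?_
  rw [eval_edgePolynomial]
  refine subgraphSum_ne_zero_of_diskInterior hκ (fun e => ?_) hu
  calc ‖lam e * y‖ = ‖y‖ * ‖lam e‖ := by rw [norm_mul, mul_comm]
    _ ≤ ‖y‖ * lamMax := by gcongr; exact hlam e
    _ < κ ^ 2 := (lt_div_iff₀ hmax).1 hy

lemma nonvanishing_edgePolynomial_diskExterior {κ lamMin : ℝ} (hκ : 0 < κ) (hmin : 0 < lamMin)
    {lam : G.edgeSet → ℂ} (hlam : ∀ e, lamMin ≤ ‖lam e‖) {u : G.vertexSet → ℕ → ℂ}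
    (hu : ∀ v, Nonvanishing (diskExterior κ) (key G u v))
    (hdeg : ∀ v, (key G u v).natDegree = deg G univ v) :
    Nonvanishing (diskExterior (κ ^ 2 / lamMin)) (edgePolynomial G lam u) := by
  refine nonvanishing_edgePolynomial_of_eval_key_ne_zero hu fun hu => .inr fun y hy => ?_
  rw [eval_edgePolynomial]
  refine subgraphSum_ne_zero_of_diskExterior hκ (fun e => ?_) hu hdeg
  calc κ ^ 2 < ‖y‖ * lamMin := (div_lt_iff₀ hmin).1 hy
    _ ≤ ‖y‖ * ‖lam e‖ := by gcongr; exact hlam e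
    _ = ‖lam e * y‖ := by rw [norm_mul, mul_comm]

end Graph

section Sector

lemma sector_eq_setOf_angle_lt (θ : ℝ) : sector θ = {z | z ≠ 0 ∧ angle 1 z < θ} := by
  ext z
  exact and_congr_right fun hz => by rw [Complex.angle_one_left hz]

lemma isOpen_sector (θ : ℝ) : IsOpen (sector θ) := by
  rw [sector_eq_setOf_angle_lt, isOpen_iff_mem_nhds]
  rintro z ⟨hz, hθ⟩
  have hcont : ContinuousAt (angle (1 : ℂ)) z :=
    (continuousAt_angle (x := ((1 : ℂ), z)) one_ne_zero hz).comp
      (Continuous.prodMk_right (1 : ℂ)).continuousAt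
  exact (isOpen_ne.eventually_mem hz).and (hcont.eventually_lt_const hθ)

lemma mem_sector_of_inner_pos {w x : ℂ} {θ : ℝ} (hw : |w.arg| + Real.pi / 2 ≤ θ)
    (h : 0 < ⟪w, x⟫_ℝ) : x ∈ sector θ := by
  have hw₀ : w ≠ 0 := by rintro rfl; simp at h
  have hx₀ : x ≠ 0 := by rintro rfl; simp at h
  have hangle : angle w x < Real.pi / 2 :=
    Real.arccos_lt_pi_div_two.2 (div_pos h (mul_pos (norm_pos_iff.2 hw₀) (norm_pos_iff.2 hx₀)))
  rw [sector_eq_setOf_angle_lt]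
  rw [← Complex.angle_one_left hw₀] at hw
  exact ⟨hx₀, by linarith [angle_le_angle_add_angle 1 w x]⟩

lemma exists_sq_eq_arg_eq_half {y : ℂ} (hy : y ≠ 0) : ∃ w : ℂ, w ^ 2 = y ∧ w.arg = y.arg / 2 := by
  refine ⟨Complex.exp (Complex.log y / 2), ?_, ?_⟩
  · rw [← Complex.exp_nat_mul, Nat.cast_ofNat, mul_div_cancel₀ _ two_ne_zero, Complex.exp_log hy]
  · have him : (Complex.log y / 2).im = y.arg / 2 := by
      rw [Complex.div_ofNat_im, Complex.log_im]
    have hlog : Complex.log (Complex.exp (Complex.log y / 2)) = Complex.log y / 2 :=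
      Complex.log_exp (by linarith [Complex.neg_pi_lt_arg y, Real.pi_pos])
        (by linarith [Complex.arg_le_pi y, Real.pi_pos])
    rw [← Complex.log_im, hlog, him]

variable {α β : Type*} {G : Graph α β} [Fintype G.edgeSet]

/-- The activities whose key polynomials are those of `u`, translated by `ε`. -/
noncomputable def translatedActivity (G : Graph α β) [Fintype G.edgeSet] (u : G.vertexSet → ℕ → ℂ)
    (ε : ℂ) : G.vertexSet → ℕ → ℂ :=
  keyActivity G fun v => Polynomial.taylor ε (key G u v)

lemma eval_key_translatedActivity (u : G.vertexSet → ℕ → ℂ) (ε : ℂ) (v : G.vertexSet) (z : ℂ) :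
    (key G (translatedActivity G u ε) v).eval z = (key G u v).eval (z + ε) := by
  rw [translatedActivity, key_keyActivity, Polynomial.taylor_eval]
  rw [Polynomial.natDegree_taylor]
  exact natDegree_binomialPolynomial_le _ _

variable [Fintype G.vertexSet]

lemma edgePolynomial_translatedActivity_zero (lam : G.edgeSet → ℂ) (u : G.vertexSet → ℕ → ℂ) :
    edgePolynomial G lam (translatedActivity G u 0) = edgePolynomial G lam u := by
  simp only [translatedActivity, Polynomial.taylor_zero]
  exact edgePolynomial_keyActivity_key lam u

lemma continuous_eval_edgePolynomial_translatedActivity (lam : G.edgeSet → ℂ)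
    (u : G.vertexSet → ℕ → ℂ) (y : ℂ) :
    Continuous fun ε => (edgePolynomial G lam (translatedActivity G u ε)).eval y := by
  simp only [eval_edgePolynomial, subgraphSum, translatedActivity, keyActivity,
    Polynomial.taylor_coeff]
  fun_prop

/-- Let `w ^ 2 = y`. Translated by `ε`, the key polynomials have no zeros in the half-plane
`0 < ⟪w, z + ε⟫`, whose boundary is parallel to `i w`. -/
lemma eval_edgePolynomial_translatedActivity_ne_zero {a : ℝ} (ha : 0 ≤ a) {lam : G.edgeSet → ℂ}
    (hlam : ∀ e, 0 ≤ lam e) {u : G.vertexSet → ℕ → ℂ}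
    (hu : ∀ v, ∀ z ∈ sector (Real.pi - a), (key G u v).eval z ≠ 0) {ε : ℝ} (hε : 0 < ε) {y : ℂ}
    (hy : y ∈ sector (Real.pi - 2 * a)) :
    (edgePolynomial G lam (translatedActivity G u ε)).eval y ≠ 0 := by
  obtain ⟨hy₀, hyarg⟩ := hy
  obtain ⟨w, rfl, harg⟩ := exists_sq_eq_arg_eq_half hy₀
  have hwarg : |w.arg| < Real.pi / 2 - a := by
    rw [harg, abs_div, abs_two]
    linarith
  have hre : 0 < w.re :=
    (Complex.abs_arg_lt_pi_div_two_iff.1 (by linarith)).resolve_right (by rintro rfl; simp at hy₀)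
  have hmem : ∀ z, z ∈ circularRegion 0 w (ε * w.re) ↔ 0 < ⟪w, z + ε⟫_ℝ := by
    intro z
    simp [circularRegion, Complex.inner, add_mul]
  have hperp : ∀ r : ℝ, r * Complex.I * w ∈ circularRegion 0 w (ε * w.re) := by
    intro r
    have horth : ⟪w, r * Complex.I * w⟫_ℝ = 0 := by
      simp only [Complex.inner, Complex.mul_re, Complex.mul_im, Complex.I_re, Complex.I_im,
        Complex.ofReal_re, Complex.ofReal_im, Complex.conj_re, Complex.conj_im]
      ring
    rw [hmem, inner_add_right, horth, zero_add]
    simpa [Complex.inner] using mul_pos hε hre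
  rw [eval_edgePolynomial]
  refine subgraphSum_ne_zero (isLaguerre_circularRegion le_rfl w (ε * w.re))
    ⟨_, hperp 0⟩ (fun e => ?_) fun v z hz => ?_
  · obtain ⟨r, hr, hlam⟩ : ∃ r : ℝ, 0 ≤ r ∧ (r : ℂ) = lam e :=
      RCLike.nonneg_iff_exists_ofReal.1 (hlam e)
    refine ⟨_, hperp (√r), by simpa using hperp (-√r), ?_⟩
    rw [← hlam, mul_pow, mul_pow, Complex.I_sq, ← Complex.ofReal_pow, Real.sq_sqrt hr]
    ring
  · rw [eval_key_translatedActivity]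
    exact hu v _ (mem_sector_of_inner_pos (by linarith) ((hmem z).1 hz))

lemma nonvanishing_edgePolynomial_sector {a : ℝ} (ha : 0 ≤ a) {lam : G.edgeSet → ℂ}
    (hlam : ∀ e, 0 ≤ lam e) {u : G.vertexSet → ℕ → ℂ}
    (hu : ∀ v, Nonvanishing (sector (Real.pi - a)) (key G u v)) :
    Nonvanishing (sector (Real.pi - 2 * a)) (edgePolynomial G lam u) := by
  refine nonvanishing_edgePolynomial_of_eval_key_ne_zero hu fun hu => ?_
  refine eq_zero_or_eval_ne_zero_of_tendsto (l := 𝓝[>] (0 : ℝ))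
    (p := fun ε => edgePolynomial G lam (translatedActivity G u (ε : ℂ)))
    (.of_forall fun ε => natDegree_edgePolynomial_le _ _) (fun y => ?_) (isOpen_sector _) ?_
  · rw [← edgePolynomial_translatedActivity_zero]
    have hcont := (continuous_eval_edgePolynomial_translatedActivity lam u y).comp
      Complex.continuous_ofReal
    simpa [Function.comp_def] using (hcont.tendsto 0).mono_left nhdsWithin_le_nhds
  · filter_upwards [self_mem_nhdsWithin] with ε hε y hy
    exact eval_edgePolynomial_translatedActivity_ne_zero ha hlam hu hε hy

end Sector

end WeightedSubgraphs

open WeightedSubgraphs in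
theorem corollary3p3 {α β : Type*} (G : Graph α β) [Fintype G.vertexSet] [Fintype G.edgeSet]
    (lam : G.edgeSet → ℂ) (u : G.vertexSet → ℕ → ℂ) :
    -- `W(y)` is the polynomial `Z(G, lam, u; y^{1/2} 1)` in `y`; the first condition determines it
    ∃ W : ℂ[X],
      (∀ y s : ℂ, s ^ 2 = y → W.eval y = MvPolynomial.eval (fun _ => s) (Z G lam u)) ∧
      -- part (a)
      (∀ a : ℝ, 0 ≤ a → a < Real.pi / 2 →
        (∀ e, 0 ≤ lam e) →
        (∀ v, Nonvanishing (sector (Real.pi - a)) (key G u v)) →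
        Nonvanishing (sector (Real.pi - 2 * a)) W) ∧
      -- part (b)
      (∀ κ lamMax : ℝ, 0 < κ → 0 < lamMax →
        (∀ e, ‖lam e‖ ≤ lamMax) →
        (∀ v, Nonvanishing (diskInterior κ) (key G u v)) →
        Nonvanishing (diskInterior (κ ^ 2 / lamMax)) W) ∧
      -- part (c)
      (∀ κ lamMin : ℝ, 0 < κ → 0 < lamMin →
        (∀ e, lamMin ≤ ‖lam e‖) →
        (∀ v, Nonvanishing (diskExterior κ) (key G u v)) →
        (∀ v, (key G u v).degree = (deg G Finset.univ v : WithBot ℕ)) →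
        Nonvanishing (diskExterior (κ ^ 2 / lamMin)) W) := by
  refine ⟨edgePolynomial G lam u, ?_, ?_, ?_, ?_⟩
  · rintro _ s rfl
    exact eval_edgePolynomial_sq lam u s
  · exact fun a ha _ hlam hu => nonvanishing_edgePolynomial_sector ha hlam hu
  · exact fun κ lamMax hκ hmax hlam hu => nonvanishing_edgePolynomial_diskInterior hκ hmax hlam hu
  · exact fun κ lamMin hκ hmin hlam hu hdeg => nonvanishing_edgePolynomial_diskExterior hκ hmin
      hlam hu fun v => Polynomial.natDegree_eq_of_degree_eq_some (hdeg v)
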